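/- Let $r\ge 2$, let $p_1<p_2<\cdots<p_r$ be primes and $n_1,\dots,n_r$ positive integers, and let $G$ be a finite non-cyclic nilpotent group of order $n=p_1^{n_1}p_2^{n_2}\cdots p_r^{n_r}$. For $1\le i\le r$ let $P_i$ be the Sylow $p_i$-subgroup of $G$. Suppose that, for some $k\in\{1,\dots,r\}$, $P_k$ is non-cyclic and $P_i$ is cyclic for every $i\ne k$, and that, if $p_k=2$ (that is, if $k=1$ and $p_1=2$), $P_k$ is not a generalized quaternion $2$-group. Let $Q=P_1\cdots P_{k-1}P_{k+1}\cdots P_r$. The power graph $\mathcal{P}(G)$ is the simple graph with vertex set $G$ in which two distinct elements are adjacent if and only if one of them is an integral power of the other. A cut-set of a finite graph is a set $X$ of vertices such that the subgraph induced on the complement of $X$ is disconnected; a minimum cut-set is a cut-set of least cardinality among all cut-sets; and the vertex connectivity $\kappa$ is the least number of vertices whose removal leaves a graph that is disconnected or has only one vertex. Let $\phi$ denote Euler's totient function. If $p_k\ge r+1$ or $2\phi(p_1p_2\cdots p_{r-1})>p_1p_2\cdots p_{r-1}$, then $Q$ is the only minimum cut-set of $\mathcal{P}(G)$, and hence $\kappa(\mathcal{P}(G))=n/p_k^{n_k}$.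 -/

import Mathlib

open scoped Pointwise

namespace PowerGraph

/-- The power graph of a group: distinct elements are adjacent iff one of them is an integral
power of the other. -/
def powerGraph (G : Type*) [Group G] : SimpleGraph G where
  Adj x y := x ≠ y ∧ ((∃ m : ℤ, y ^ m = x) ∨ (∃ m : ℤ, x ^ m = y))
  symm := ⟨fun _ _ h => ⟨h.1.symm, h.2.symm⟩⟩
  loopless := ⟨fun _ h => h.1 rfl⟩

/-- A set of vertices is a cut-set if the induced subgraph on its complement is disconnected,
that is, has two vertices that no walk joins. (An empty complement does not count.) -/
def IsCutSet {V : Type*} (Γ : SimpleGraph V) (X : Set V) : Prop :=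
  ¬ (Γ.induce Xᶜ).Preconnected

/-- A cut-set of a finite graph that has the least size among all cut-sets. -/
def IsMinimumCutSet {V : Type*} [Finite V] (Γ : SimpleGraph V) (X : Set V) : Prop :=
  IsCutSet Γ X ∧ ∀ Y : Set V, IsCutSet Γ Y → X.ncard ≤ Y.ncard

/-- The vertex connectivity of a finite non-empty graph: the least number of vertices whose removal
leaves a graph that is disconnected or has only one vertex. -/
noncomputable def vertexConnectivity {V : Type*} [Finite V] [Nonempty V]
    (Γ : SimpleGraph V) : ℕ :=
  sInf {m : ℕ | ∃ X : Set V, (IsCutSet Γ X ∨ Xᶜ.ncard = 1) ∧ X.ncard = m}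

/-- The generalized quaternion `2`-groups: those isomorphic to the generalized quaternion group of
order `2 ^ (m + 2)` for some `m ≥ 1` (Mathlib's `QuaternionGroup N` has order `4 * N`). -/
def IsGeneralizedQuaternion (H : Type*) [Group H] : Prop :=
  ∃ m : ℕ, 1 ≤ m ∧ Nonempty (H ≃* QuaternionGroup (2 ^ m))

/-- The product set `P₁ ⋯ Pₖ₋₁ Pₖ₊₁ ⋯ Pᵣ`, in this order, of a family of subsets `P` of a group with
the factor of index `k` left out. -/
def prodOmit {G : Type*} [Group G] {r : ℕ} (P : Fin r → Set G) (k : Fin r) : Set G :=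
  (((List.finRange r).filter (fun i => i ≠ k)).map P).prod

end PowerGraph

namespace PowerGraph

/-! As `G` is nilpotent, it is the direct product of `P k` and the cyclic group `Q = ⟨q⟩`. An
element outside `Q` has order divisible by `p k`, so it generates a cyclic group with exactly one
subgroup of order `p k`, and adjacent elements outside `Q` share that subgroup. Since `P k` is
neither cyclic nor generalized quaternion, it has two subgroups of order `p k`, so removing `Q`
disconnects the graph (`isCutSet_zpowers`).

Conversely, let `X` be a cut-set with `|X| ≤ |Q|`. Every `g` lies in a cyclic group `⟨h⟩` that
contains `Q` properly. It has at least `(p k - 1) φ(|Q|) ≥ |Q|` generators, and `1 ∈ X` is not one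
of them, so some generator avoids `X`. A vertex of `Q` outside `X` would then be linked to
everything; hence `Q ⊆ X` and `X = Q` (`eq_zpowers_of_isCutSet`). The condition on the primes serves
only for `|Q| ≤ (p k - 1) φ(|Q|)` (`prod_pow_le_pred_mul_totient`). -/

/-! ### Finite `p`-groups: self-centralizing subgroups and a cyclicity criterion. -/

theorem _root_.IsPGroup.exists_mem_center_of_normal {p : ℕ} [Fact p.Prime] {G : Type*} [Group G]
    [Finite G] (hG : IsPGroup p G) (N : Subgroup G) [N.Normal] (hN : N ≠ ⊥) :
    ∃ z ∈ N, z ∈ Subgroup.center G ∧ z ≠ 1 := by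
  have hG' : IsPGroup p (ConjAct G) := hG
  have : Nontrivial N := (Subgroup.nontrivial_iff_ne_bot N).2 hN
  have hdvd : p ∣ Nat.card N := by
    rcases (hG.to_subgroup N).card_eq_or_dvd with h | h
    · have := Finite.one_lt_card (α := N); omega
    · exact h
  obtain ⟨z, hz, hz1⟩ := hG'.exists_fixed_point_of_prime_dvd_card_of_fixed_point N hdvd
    (a := 1) (fun g => smul_one g)
  refine ⟨z, z.2, ?_, fun h => hz1 (Subtype.ext h.symm)⟩
  rw [Subgroup.mem_center_iff]
  intro g
  have h := congrArg Subtype.val (hz (ConjAct.toConjAct g))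
  rw [ConjAct.Subgroup.val_conj_smul, ConjAct.toConjAct_smul] at h
  rw [mul_inv_eq_iff_eq_mul] at h
  exact h

/-- Take `A` maximal among abelian normal subgroups. If its centralizer `C` were larger, `C/A` would
contain a nontrivial central element `zA` of `G/A`, and `A⟨z⟩` would be a larger abelian normal
subgroup. -/
theorem _root_.IsPGroup.exists_normal_selfCentralizing {p : ℕ} [Fact p.Prime] {G : Type*} [Group G]
    [Finite G] (hG : IsPGroup p G) :
    ∃ A : Subgroup G, A.Normal ∧ A ≤ Subgroup.centralizer A ∧ Subgroup.centralizer A ≤ A := by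
  obtain ⟨A, ⟨hAn, hAc⟩, hmax⟩ := (Set.toFinite
    {A : Subgroup G | A.Normal ∧ A ≤ Subgroup.centralizer A}).exists_maximal
    ⟨⊥, inferInstance, bot_le⟩
  refine ⟨A, hAn, hAc, ?_⟩
  by_contra hC
  set C : Subgroup G := Subgroup.centralizer A
  have hCn : (C.map (QuotientGroup.mk' A)).Normal :=
    Subgroup.Normal.map inferInstance _ (QuotientGroup.mk'_surjective A)
  have hCb : C.map (QuotientGroup.mk' A) ≠ ⊥ := by
    rw [Ne, Subgroup.map_eq_bot_iff, QuotientGroup.ker_mk']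
    exact hC
  obtain ⟨_, ⟨z, hzC, rfl⟩, hz, hz1⟩ := (hG.to_quotient A).exists_mem_center_of_normal _ hCb
  have hzA : z ∉ A := fun h => hz1 ((QuotientGroup.eq_one_iff z).2 h)
  have hcomm : ∀ g : G, g * z * g⁻¹ * z⁻¹ ∈ A := by
    intro g
    rw [← QuotientGroup.eq_one_iff]
    have := Subgroup.mem_center_iff.1 hz (QuotientGroup.mk' A g)
    change QuotientGroup.mk' A (g * z * g⁻¹ * z⁻¹) = 1
    rw [map_mul, map_mul, map_mul, this, map_inv, map_inv]
    group
  have hBn : (A ⊔ Subgroup.zpowers z).Normal := by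
    refine ⟨fun b hb g => ?_⟩
    have hle : A ⊔ Subgroup.zpowers z ≤
        (A ⊔ Subgroup.zpowers z).comap (MulAut.conj g).toMonoidHom := by
      refine sup_le (fun a ha => ?_) ?_
      · exact Subgroup.mem_sup_left (hAn.conj_mem a ha g)
      · rw [Subgroup.zpowers_le, Subgroup.mem_comap]
        have h := Subgroup.mul_mem _ (Subgroup.mem_sup_left (T := Subgroup.zpowers z) (hcomm g))
          (Subgroup.mem_sup_right (S := A) (Subgroup.mem_zpowers z))
        simpa using h
    exact hle hb
  have hBc : A ⊔ Subgroup.zpowers z ≤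
      Subgroup.centralizer ((A ⊔ Subgroup.zpowers z : Subgroup G) : Set G) := by
    have h1 : A ⊔ Subgroup.zpowers z ≤ C := sup_le hAc (by rwa [Subgroup.zpowers_le])
    have h2 : A ≤ Subgroup.centralizer ((A ⊔ Subgroup.zpowers z : Subgroup G) : Set G) :=
      Subgroup.le_centralizer_iff.1 h1
    refine sup_le h2 ?_
    rw [Subgroup.le_centralizer_iff]
    refine sup_le ?_ (Subgroup.le_centralizer _)
    rw [Subgroup.le_centralizer_iff, Subgroup.zpowers_le]
    exact hzC
  have := hmax ⟨hBn, hBc⟩ le_sup_left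
  exact hzA (this (Subgroup.mem_sup_right (Subgroup.mem_zpowers z)))

theorem _root_.IsPGroup.exists_notMem_pow_mem {p : ℕ} {G : Type*} [Group G] (hG : IsPGroup p G)
    {A : Subgroup G} {y : G} (hy : y ∉ A) : ∃ k : ℕ, y ^ p ^ k ∉ A ∧ (y ^ p ^ k) ^ p ∈ A := by
  classical
  have hex : ∃ k : ℕ, y ^ p ^ k ∈ A := by
    obtain ⟨k, hk⟩ := hG y
    exact ⟨k, hk ▸ A.one_mem⟩
  obtain ⟨k, hk⟩ : ∃ k, Nat.find hex = k + 1 := by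
    refine Nat.exists_eq_succ_of_ne_zero fun h => hy ?_
    simpa [h] using Nat.find_spec hex
  refine ⟨k, Nat.find_min hex (by omega), ?_⟩
  rw [← pow_mul, ← pow_succ, ← hk]
  exact Nat.find_spec hex

/-- Let `g` have maximal order, and let `x ∉ ⟨g⟩` with `x ^ p = g ^ j`. The exponent forces `j = p *
l`, so `x * g ^ (-l)` is killed by `p` and lies in `⟨g⟩`, a contradiction. -/
theorem _root_.IsPGroup.isCyclic_of_comm {p : ℕ} [hp : Fact p.Prime] {G : Type*} [CommGroup G]
    [Finite G] (hG : IsPGroup p G)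
    (hU : ∀ x y : G, x ^ p = 1 → x ≠ 1 → y ^ p = 1 → y ∈ Subgroup.zpowers x) : IsCyclic G := by
  obtain ⟨g, hg⟩ := Monoid.exists_orderOf_eq_exponent (G := G) Monoid.ExponentExists.of_finite
  by_contra hcyc
  have hlt : ∃ y, y ∉ Subgroup.zpowers g := by
    by_contra! h
    exact hcyc ⟨g, h⟩
  obtain ⟨y, hy⟩ := hlt
  obtain ⟨k, hxA, hxp⟩ := hG.exists_notMem_pow_mem hy
  set x := y ^ p ^ k
  obtain ⟨n, hn⟩ := IsPGroup.iff_orderOf.1 hG g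
  have hn0 : n ≠ 0 := by
    rintro rfl
    have h1 : x ^ Monoid.exponent G = 1 := Monoid.pow_exponent_eq_one x
    rw [← hg, hn] at h1
    simp only [pow_zero, pow_one] at h1
    exact hxA (h1 ▸ Subgroup.one_mem _)
  obtain ⟨n, rfl⟩ := Nat.exists_eq_succ_of_ne_zero hn0
  obtain ⟨j, hj⟩ := hxp
  simp only at hj
  have hpj : (p : ℤ) ∣ j := by
    have h1 : x ^ Monoid.exponent G = 1 := Monoid.pow_exponent_eq_one x
    rw [← hg, hn, Nat.succ_eq_add_one, pow_succ', pow_mul, ← hj, ← zpow_natCast, ← zpow_mul,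
      ← orderOf_dvd_iff_zpow_eq_one, hn] at h1
    push_cast at h1
    rw [pow_succ', mul_comm j] at h1
    rw [mul_comm (p : ℤ)] at h1
    exact Int.dvd_of_mul_dvd_mul_left (pow_ne_zero _ (by exact_mod_cast hp.out.ne_zero)) h1
  obtain ⟨l, rfl⟩ := hpj
  have hx1 : (x * g ^ (-l)) ^ p = 1 := by
    rw [mul_pow, ← hj, ← zpow_natCast (g ^ (-l)), ← zpow_mul, ← zpow_add]
    ring_nf
    simp
  have hg1 : (g ^ p ^ n) ^ p = 1 := by
    rw [← pow_mul, ← pow_succ, ← hn, pow_orderOf_eq_one]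
  have hg2 : g ^ p ^ n ≠ 1 := by
    intro h
    have := orderOf_dvd_of_pow_eq_one h
    rw [hn, Nat.pow_dvd_pow_iff_le_right hp.out.one_lt] at this
    omega
  have h2 := hU _ _ hg1 hg2 hx1
  have h3 : x * g ^ (-l) ∈ Subgroup.zpowers g :=
    Subgroup.zpowers_le.2 (Subgroup.npow_mem_zpowers g _) h2
  exact hxA ((Subgroup.mul_mem_cancel_right _ (Subgroup.zpow_mem_zpowers g _)).1 h3)

/-! ### Action of an element on a cyclic `p`-subgroup. -/

theorem mul_zpow_of_conj {G : Type*} [Group G] {a x : G} {s : ℤ} (h : x * a * x⁻¹ = a ^ s)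
    (m : ℤ) : x * a ^ m = a ^ (s * m) * x := by
  rw [← mul_inv_eq_iff_eq_mul, ← conj_zpow, h, zpow_mul]

theorem pow_conj_of_conj {G : Type*} [Group G] {a x : G} {s : ℤ} (h : x * a * x⁻¹ = a ^ s)
    (i : ℕ) : x ^ i * a * (x ^ i)⁻¹ = a ^ (s ^ i) := by
  induction i with
  | zero => simp
  | succ i ih =>
    calc x ^ (i + 1) * a * (x ^ (i + 1))⁻¹ = x * (x ^ i * a * (x ^ i)⁻¹) * x⁻¹ := by
          rw [pow_succ']; group
      _ = a ^ (s ^ (i + 1)) := by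
          rw [ih, mul_zpow_of_conj h, mul_inv_cancel_right, pow_succ']

theorem zpow_mul_pow_of_conj {G : Type*} [Group G] {a x : G} {s : ℤ} (h : x * a * x⁻¹ = a ^ s)
    (l : ℤ) (i : ℕ) :
    (a ^ l * x) ^ i = a ^ (l * ∑ t ∈ Finset.range i, s ^ t) * x ^ i := by
  induction i with
  | zero => simp
  | succ i ih =>
    set M := l * ∑ t ∈ Finset.range i, s ^ t with hM
    calc (a ^ l * x) ^ (i + 1) = a ^ l * (x * a ^ M) * x ^ i := by
          rw [pow_succ', ih]; group
      _ = a ^ (l + s * M) * x ^ (i + 1) := by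
          rw [mul_zpow_of_conj h, zpow_add, pow_succ']; group
      _ = _ := by
          rw [Finset.sum_range_succ', hM]
          simp only [pow_succ, pow_zero]
          rw [← Finset.sum_mul]
          congr 2
          ring

/-- `N` has `p`-adic valuation 1, so `d` has valuation exactly `n - 1`, whence `p ∣ j` and `l * N ≡
-j` is solvable. -/
theorem exists_dvd_mul_add_of_not_dvd {p : ℕ} (hp : p.Prime) {n : ℕ} {N u d j : ℤ}
    (hN : N = p * u) (hu : ¬ (p : ℤ) ∣ u) (hNd : (p : ℤ) ^ n ∣ N * d) (hd : ¬ (p : ℤ) ^ n ∣ d)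
    (hj : (p : ℤ) ^ n ∣ j * d) : ∃ l : ℤ, (p : ℤ) ^ n ∣ l * N + j := by
  have hpi : Prime (p : ℤ) := Nat.prime_iff_prime_int.1 hp
  rcases n with _ | n
  · simp
  have hcop : IsCoprime ((p : ℤ) ^ (n + 1)) u := ((Prime.coprime_iff_not_dvd hpi).2 hu).pow_left
  have h1 : (p : ℤ) ^ n ∣ d := by
    rw [hN, mul_assoc, pow_succ'] at hNd
    have h2 := Int.dvd_of_mul_dvd_mul_left hpi.ne_zero hNd
    exact ((Prime.coprime_iff_not_dvd hpi).2 hu).pow_left.dvd_of_dvd_mul_left h2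
  obtain ⟨w, rfl⟩ := h1
  have hw : ¬ (p : ℤ) ∣ w := fun h => hd (by rw [pow_succ]; exact mul_dvd_mul_left _ h)
  have hpj : (p : ℤ) ∣ j := by
    rw [pow_succ, mul_left_comm] at hj
    have h2 := Int.dvd_of_mul_dvd_mul_left (pow_ne_zero _ hpi.ne_zero) hj
    exact (hpi.dvd_or_dvd h2).resolve_right hw
  obtain ⟨j', rfl⟩ := hpj
  obtain ⟨b, c, hbc⟩ := hcop
  refine ⟨-j' * c, ?_⟩
  refine ⟨p * j' * b, ?_⟩
  rw [hN]
  linear_combination (-(p : ℤ) * j') * hbc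

/-- If `x` acts on `⟨a⟩` as the `s`-th power and `x ^ p = a ^ j`, then `(a ^ l * x) ^ p = a ^ (l * N
+ j)` with `N` the geometric sum; the first alternative makes this 1. By Fermat `s ≡ 1` mod `p`, so
for odd `p`, `N ≡ p` mod `p ^ 2`. For `p = 2`, `N = s + 1`, and only `s ≡ 3` mod 4 leaves room for
the exception. -/
theorem geom_sum_dvd_cases {p : ℕ} (hp : p.Prime) {n : ℕ} (hn : n ≠ 0) {s j : ℤ}
    (hs : (p : ℤ) ^ n ∣ s ^ p - 1) (hs1 : ¬ (p : ℤ) ^ n ∣ s - 1)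
    (hj : (p : ℤ) ^ n ∣ j * (s - 1)) :
    (∃ l : ℤ, (p : ℤ) ^ n ∣ l * (∑ t ∈ Finset.range p, s ^ t) + j) ∨
      (p = 2 ∧ (p : ℤ) ^ n ∣ s + 1) := by
  have : Fact p.Prime := ⟨hp⟩
  have hpi : Prime (p : ℤ) := Nat.prime_iff_prime_int.1 hp
  have hps : (p : ℤ) ∣ s - 1 := by
    have h1 : (p : ℤ) ∣ s ^ p - 1 := (dvd_pow_self _ hn).trans hs
    rw [← ZMod.intCast_zmod_eq_zero_iff_dvd] at h1 ⊢
    push_cast at h1 ⊢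
    rwa [ZMod.pow_card] at h1
  have hNd : (p : ℤ) ^ n ∣ (∑ t ∈ Finset.range p, s ^ t) * (s - 1) := by rwa [geom_sum_mul]
  rcases hp.eq_two_or_odd' with rfl | hodd
  · have hsum : ∑ t ∈ Finset.range 2, s ^ t = s + 1 := by
      simp [Finset.sum_range_succ, add_comm]
    rw [hsum] at hNd ⊢
    push_cast at *
    by_cases h4 : (4 : ℤ) ∣ s - 1
    · left
      obtain ⟨c, hc⟩ := h4
      exact exists_dvd_mul_add_of_not_dvd Nat.prime_two (u := 2 * c + 1)
        (by push_cast; linarith) (by push_cast; omega) (by exact_mod_cast hNd)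
        (by exact_mod_cast hs1) (by exact_mod_cast hj)
    · obtain ⟨w, hw⟩ := hps
      obtain ⟨n, rfl⟩ := Nat.exists_eq_succ_of_ne_zero hn
      have hcop : IsCoprime ((2 : ℤ) ^ n) w :=
        ((Prime.coprime_iff_not_dvd Int.prime_two).2 (by omega)).pow_left
      rw [hw, Nat.succ_eq_add_one, pow_succ, mul_left_comm, ← mul_comm (2 : ℤ)] at hj hNd
      have hj2 := hcop.dvd_of_dvd_mul_right
        (Int.dvd_of_mul_dvd_mul_left (by norm_num) hj)
      have hs2 := hcop.dvd_of_dvd_mul_right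
        (Int.dvd_of_mul_dvd_mul_left (by norm_num) hNd)
      obtain ⟨c, hc⟩ := hs2
      obtain ⟨j', rfl⟩ := hj2
      rcases Int.even_or_odd' c with ⟨e, rfl | rfl⟩
      · right
        exact ⟨trivial, e, by rw [hc, Nat.succ_eq_add_one]; ring⟩
      · left
        exact ⟨j', j' * (e + 1), by rw [hc, Nat.succ_eq_add_one]; ring⟩
  · left
    obtain ⟨b, hb⟩ := hps
    have h2 := odd_sq_dvd_geom_sum₂_sub (a := (1 : ℤ)) (b := b) hodd
    have hs' : (1 : ℤ) + p * b = s := by linarith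
    simp only [hs', one_pow, mul_one] at h2
    obtain ⟨c, hc⟩ := h2
    refine exists_dvd_mul_add_of_not_dvd hp (u := 1 + p * c)
      (by linear_combination hc) ?_ hNd hs1 hj
    intro h
    exact hpi.not_isUnit (isUnit_of_dvd_one ((dvd_add_left (dvd_mul_right _ c)).1 h))

/-- If all elements of order `p` lie in the cyclic `p`-subgroup `⟨a⟩`, an element outside of it that
normalizes but does not centralize it, and whose `p`-th power lies in it, inverts `a`. -/
theorem conj_eq_inv_of_pow_mem {p : ℕ} (hp : p.Prime) {G : Type*} [Group G] {a x : G} {n : ℕ}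
    (ha : orderOf a = p ^ n) (hU : ∀ y : G, y ^ p = 1 → y ∈ Subgroup.zpowers a)
    (hx : x ∉ Subgroup.zpowers a) (hxp : x ^ p ∈ Subgroup.zpowers a)
    (hconj : x * a * x⁻¹ ∈ Subgroup.zpowers a) (hne : x * a * x⁻¹ ≠ a) :
    p = 2 ∧ x * a * x⁻¹ = a⁻¹ := by
  obtain ⟨s, hs⟩ := hconj
  obtain ⟨j, hj⟩ := hxp
  simp only at hs hj
  have key : ∀ m m' : ℤ, a ^ m = a ^ m' ↔ (p : ℤ) ^ n ∣ m - m' := by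
    intro m m'
    rw [← mul_inv_eq_one, ← zpow_neg, ← zpow_add, ← orderOf_dvd_iff_zpow_eq_one, ha,
      ← sub_eq_add_neg]
    push_cast
    rfl
  have hn : n ≠ 0 := by
    rintro rfl
    rw [pow_zero, orderOf_eq_one_iff] at ha
    exact hne (by simp [ha])
  have h1 : (p : ℤ) ^ n ∣ s ^ p - 1 := by
    rw [← key, ← pow_conj_of_conj hs.symm, ← hj, zpow_one, mul_inv_eq_iff_eq_mul,
      ← zpow_one_add, ← zpow_add_one, add_comm]
  have h2 : ¬ (p : ℤ) ^ n ∣ s - 1 := by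
    rw [← key, hs, zpow_one]
    exact hne
  have h3 : (p : ℤ) ^ n ∣ j * (s - 1) := by
    have : a ^ (s * j) = a ^ j := by
      have h4 := mul_zpow_of_conj hs.symm j
      rw [hj, ← pow_succ', pow_succ] at h4
      rw [hj]
      exact (mul_right_cancel h4).symm
    rw [key] at this
    convert this using 1
    ring
  rcases geom_sum_dvd_cases hp hn h1 h2 h3 with ⟨l, hl⟩ | ⟨h, hl⟩
  · exfalso
    have h4 : (a ^ l * x) ^ p = 1 := by
      rw [zpow_mul_pow_of_conj hs.symm, ← hj, ← zpow_add, ← zpow_zero a, key]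
      simpa using hl
    exact hx ((Subgroup.mul_mem_cancel_left _ (Subgroup.zpow_mem_zpowers a l)).1 (hU _ h4))
  · refine ⟨h, ?_⟩
    rw [← hs, ← zpow_neg_one, key]
    simpa using hl

/-! ### `p`-groups with one subgroup of order `p`, and the quaternion groups. -/

/-- A group with a cyclic subgroup `⟨a⟩` of order `2 * N` and an element `x` outside of it which
inverts `a` and squares to `a ^ N` is a generalized quaternion group, if `⟨a⟩` has index two. -/
theorem nonempty_mulEquiv_quaternionGroup {G : Type*} [Group G] {N : ℕ} {a x : G}
    (ha : orderOf a = 2 * N) (hx : x ∉ Subgroup.zpowers a) (hxa : x * a * x⁻¹ = a⁻¹)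
    (hx2 : x ^ 2 = a ^ N)
    (hindex : ∀ g, g ∉ Subgroup.zpowers a → x⁻¹ * g ∈ Subgroup.zpowers a) :
    Nonempty (G ≃* QuaternionGroup N) := by
  let e : ZMod (2 * N) → G := fun i => a ^ (i.cast : ℤ)
  have key : ∀ m m' : ℤ, a ^ m = a ^ m' ↔ (m : ZMod (2 * N)) = m' := by
    intro m m'
    rw [zpow_eq_zpow_iff_modEq, ha, ZMod.intCast_eq_intCast_iff]
  have he : ∀ z : ℤ, e (z : ZMod (2 * N)) = a ^ z := fun z => by
    simp only [e]
    rw [key]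
    simp
  have he' : ∀ i, ∃ z : ℤ, (z : ZMod (2 * N)) = i := ZMod.intCast_surjective
  have hadd : ∀ i j, e (i + j) = e i * e j := by
    intro i j
    obtain ⟨z, rfl⟩ := he' i
    obtain ⟨w, rfl⟩ := he' j
    rw [← Int.cast_add, he, he, he, zpow_add]
  have hnegx : ∀ i, e i * x = x * e (-i) := by
    intro i
    obtain ⟨z, rfl⟩ := he' i
    rw [← Int.cast_neg, he, he, mul_zpow_of_conj (s := -1) (by rw [hxa, zpow_neg_one])]
    simp
  have hinj : Function.Injective e := by
    intro i j h
    obtain ⟨z, rfl⟩ := he' i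
    obtain ⟨w, rfl⟩ := he' j
    rwa [he, he, key] at h
  have hmem : ∀ i, e i ∈ Subgroup.zpowers a := fun i => Subgroup.zpow_mem_zpowers a _
  have hN : e (N : ZMod (2 * N)) = x ^ 2 := by
    rw [hx2]
    have := he (N : ℤ)
    rwa [Int.cast_natCast, zpow_natCast] at this
  let f : QuaternionGroup N → G := fun q => match q with
    | .a i => e i
    | .xa i => x * e i
  have hmul : ∀ u v, f (u * v) = f u * f v := by
    rintro (i | i) (j | j)
    · exact hadd i j
    · change x * e (j - i) = e i * (x * e j)
      rw [← mul_assoc, hnegx, mul_assoc, ← hadd, sub_eq_neg_add]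
    · change x * e (i + j) = x * e i * e j
      rw [hadd, mul_assoc]
    · change e (N + j - i) = x * e i * (x * e j)
      rw [mul_assoc, ← mul_assoc (e i), hnegx, add_sub_assoc, hadd, hN, sub_eq_neg_add, hadd, sq]
      group
  have hfinj : Function.Injective f := by
    rintro (i | i) (j | j) h
    · exact congrArg _ (hinj h)
    · exfalso
      have h' : e i = x * e j := h
      exact hx ((Subgroup.mul_mem_cancel_right _ (hmem j)).1 (h' ▸ hmem i))
    · exfalso
      have h' : x * e i = e j := h
      exact hx ((Subgroup.mul_mem_cancel_right _ (hmem i)).1 (h' ▸ hmem j))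
    · exact congrArg _ (hinj (mul_left_cancel h))
  have hfsurj : Function.Surjective f := by
    intro g
    by_cases hg : g ∈ Subgroup.zpowers a
    · obtain ⟨z, rfl⟩ := hg
      exact ⟨.a z, he z⟩
    · obtain ⟨z, hz⟩ := hindex g hg
      refine ⟨.xa z, ?_⟩
      change x * e z = g
      rw [he]
      simp only at hz
      rw [hz, mul_inv_cancel_left]
  exact ⟨(MulEquiv.ofBijective (MulHom.mk f hmul) ⟨hfinj, hfsurj⟩).symm⟩

/-- A finite `p`-group with a single subgroup of order `p` is cyclic or generalized quaternion. -/
theorem _root_.IsPGroup.isCyclic_or_isGeneralizedQuaternion {p : ℕ} [hp : Fact p.Prime]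
    {G : Type*} [Group G] [Finite G] (hG : IsPGroup p G)
    (hU : ∀ x y : G, x ^ p = 1 → x ≠ 1 → y ^ p = 1 → y ∈ Subgroup.zpowers x) :
    IsCyclic G ∨ p = 2 ∧ IsGeneralizedQuaternion G := by
  obtain ⟨A, hAn, hAc, hCA⟩ := hG.exists_normal_selfCentralizing
  have hAcyc : IsCyclic A := by
    let _ : CommGroup A := { (inferInstance : Group A) with
      mul_comm := fun x y => Subtype.ext (hAc y.2 x x.2) }
    refine IsPGroup.isCyclic_of_comm (hG.to_subgroup A) fun x y hx hx1 hy => ?_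
    obtain ⟨z, hz⟩ := hU (x : G) y (by exact_mod_cast congrArg Subtype.val hx)
      (by simpa using hx1) (by exact_mod_cast congrArg Subtype.val hy)
    exact ⟨z, Subtype.ext hz⟩
  obtain ⟨a, rfl⟩ := (Subgroup.isCyclic_iff_exists_zpowers_eq_top A).1 hAcyc
  by_cases htop : ∀ g, g ∈ Subgroup.zpowers a
  · exact Or.inl ⟨a, htop⟩
  right
  push Not at htop
  obtain ⟨g₀, hg₀⟩ := htop
  obtain ⟨n, hn⟩ := IsPGroup.iff_orderOf.1 hG a
  have hcent : ∀ x, x * a * x⁻¹ = a → x ∈ Subgroup.zpowers a := by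
    intro x hx
    apply hCA
    rw [Subgroup.mem_centralizer_iff]
    rintro _ ⟨z, rfl⟩
    have hxa : Commute x a := mul_inv_eq_iff_eq_mul.1 hx
    exact (hxa.zpow_right z).eq.symm
  have hn0 : n ≠ 0 := by
    rintro rfl
    rw [pow_zero, orderOf_eq_one_iff] at hn
    subst hn
    exact hg₀ (hcent g₀ (by simp))
  obtain ⟨n, rfl⟩ := Nat.exists_eq_succ_of_ne_zero hn0
  have hUa : ∀ y : G, y ^ p = 1 → y ∈ Subgroup.zpowers a := by
    intro y hy
    refine Subgroup.zpowers_le.2 (Subgroup.npow_mem_zpowers a (p ^ n)) (hU (a ^ p ^ n) y ?_ ?_ hy)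
    · rw [← pow_mul, ← pow_succ, ← Nat.succ_eq_add_one, ← hn, pow_orderOf_eq_one]
    · intro h
      have := orderOf_dvd_of_pow_eq_one h
      rw [hn, Nat.pow_dvd_pow_iff_le_right hp.out.one_lt] at this
      omega
  have hstep : ∀ x, x ∉ Subgroup.zpowers a → x ^ p ∈ Subgroup.zpowers a →
      p = 2 ∧ x * a * x⁻¹ = a⁻¹ := fun x hx hxp =>
    conj_eq_inv_of_pow_mem hp.out hn hUa hx hxp
      (hAn.conj_mem a (Subgroup.mem_zpowers a) x) (fun h => hx (hcent x h))
  obtain ⟨k₀, hk₀, hk₀p⟩ := hG.exists_notMem_pow_mem hg₀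
  obtain ⟨rfl, hinv₀⟩ := hstep _ hk₀ hk₀p
  refine ⟨rfl, ?_⟩
  have key : ∀ m m' : ℤ, a ^ m = a ^ m' ↔ (2 : ℤ) ^ (n + 1) ∣ m - m' := by
    intro m m'
    rw [← mul_inv_eq_one, ← zpow_neg, ← zpow_add, ← orderOf_dvd_iff_zpow_eq_one, hn,
      ← sub_eq_add_neg]
    push_cast
    rfl
  -- If `a` had order 2, inverting it would be centralizing it.
  have hn1 : 1 ≤ n := by
    by_contra hlt
    obtain rfl : n = 0 := by omega
    apply hk₀
    apply hcent
    rw [hinv₀, ← zpow_neg_one]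
    nth_rewrite 2 [← zpow_one a]
    rw [key]
    norm_num
  have h4 : (4 : ℤ) ∣ 2 ^ (n + 1) := by
    have : (4 : ℤ) = 2 ^ 2 := by norm_num
    rw [this]
    exact pow_dvd_pow _ (by omega)
  have hinv : ∀ x, x ∉ Subgroup.zpowers a → x * a * x⁻¹ = a⁻¹ := by
    intro x hx
    obtain ⟨k, hk, hkp⟩ := hG.exists_notMem_pow_mem hx
    have hk2 := (hstep _ hk hkp).2
    -- For `k + 1`, conjugation by `x ^ 2 ^ k` would be a power map with exponent `t` and `t ^ 2 ≡
    -- -1` mod 4.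
    rcases k with _ | k
    · simpa using hk2
    exfalso
    obtain ⟨t, ht⟩ := hAn.conj_mem a (Subgroup.mem_zpowers a) (x ^ 2 ^ k)
    rw [pow_succ, pow_mul, pow_conj_of_conj ht.symm, ← zpow_neg_one, key] at hk2
    have h5 := h4.trans hk2
    rcases Int.even_or_odd' t with ⟨c, rfl | rfl⟩
    · ring_nf at h5
      omega
    · ring_nf at h5
      omega
  have hmul : ∀ x y, x ∉ Subgroup.zpowers a → y ∉ Subgroup.zpowers a →
      x⁻¹ * y ∈ Subgroup.zpowers a := by
    intro x y hx hy
    apply hcent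
    have h1 := hinv x hx
    have h2 := hinv y hy
    rw [← h1] at h2
    calc x⁻¹ * y * a * (x⁻¹ * y)⁻¹ = x⁻¹ * (y * a * y⁻¹) * x := by group
      _ = a := by rw [h2]; group
  set x := g₀ ^ 2 ^ k₀
  refine ⟨n, hn1, nonempty_mulEquiv_quaternionGroup (a := a) (x := x)
    (by rw [hn, Nat.succ_eq_add_one, pow_succ']) hk₀ hinv₀ ?_ (fun g hg => hmul x g hk₀ hg)⟩
  obtain ⟨j, hj⟩ := hk₀p
  simp only at hj
  -- The element `x` commutes with `x ^ 2 = a ^ j` but inverts it, so `2 ^ n ∣ j`. An even quotient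
  -- would give `x ^ 2 = 1` and so `x ∈ ⟨a⟩`; an odd one gives `x ^ 2 = a ^ 2 ^ n`.
  have hfix : (2 : ℤ) ^ (n + 1) ∣ 2 * j := by
    have h6 := mul_zpow_of_conj (s := -1) (by rw [hinv₀, zpow_neg_one]) j
    rw [hj, ← pow_succ', pow_succ] at h6
    have h7 := mul_right_cancel h6
    rw [← hj, key] at h7
    convert h7 using 1
    ring
  rw [pow_succ'] at hfix
  obtain ⟨c, rfl⟩ := Int.dvd_of_mul_dvd_mul_left (by norm_num) hfix
  rw [← hj, ← zpow_natCast, key]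
  rcases Int.even_or_odd' c with ⟨d, rfl | rfl⟩
  · exfalso
    apply hk₀
    apply hUa
    rw [← hj, ← zpow_zero a, key]
    exact ⟨d, by ring⟩
  · exact ⟨d, by push_cast; ring⟩

/-- A finite `p`-group that is neither cyclic nor generalized quaternion has two distinct subgroups
of order `p`. -/
theorem _root_.IsPGroup.exists_two_zpowers_of_orderOf_eq {p : ℕ} [hp : Fact p.Prime]
    {G : Type*} [Group G] [Finite G] (hG : IsPGroup p G) (hcyc : ¬ IsCyclic G)
    (hquat : p = 2 → ¬ IsGeneralizedQuaternion G) :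
    ∃ u v : G, orderOf u = p ∧ orderOf v = p ∧ v ∉ Subgroup.zpowers u := by
  by_contra! h
  have := hG.isCyclic_or_isGeneralizedQuaternion fun x y hx hx1 hy => by
    by_cases hy1 : y = 1
    · exact hy1 ▸ Subgroup.one_mem _
    · exact h x y (orderOf_eq_prime hx hx1) (orderOf_eq_prime hy hy1)
  rcases this with h | ⟨h, h'⟩
  · exact hcyc h
  · exact hquat h h'

/-! ### Cyclic subgroups and their generators. -/

theorem _root_.Commute.right_mem_zpowers_mul {G : Type*} [Group G] {x y : G} (h : Commute x y)
    (hco : (orderOf x).Coprime (orderOf y)) : y ∈ Subgroup.zpowers (x * y) := by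
  obtain ⟨m, hm⟩ := exists_pow_eq_self_of_coprime hco
  refine ⟨(orderOf x * m : ℕ), ?_⟩
  simp only
  rw [zpow_natCast, pow_mul, h.mul_pow, pow_orderOf_eq_one, one_mul, hm]

theorem _root_.Commute.left_mem_zpowers_mul {G : Type*} [Group G] {x y : G} (h : Commute x y)
    (hco : (orderOf x).Coprime (orderOf y)) : x ∈ Subgroup.zpowers (x * y) :=
  h.eq ▸ h.symm.right_mem_zpowers_mul hco.symm

theorem ncard_zpowers {G : Type*} [Group G] (g : G) :
    (Subgroup.zpowers g : Set G).ncard = orderOf g := by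
  rw [← Nat.card_coe_set_eq, SetLike.coe_sort_coe, Nat.card_zpowers]

/-- A cyclic group has at most one subgroup of order `p`. -/
theorem mem_zpowers_of_orderOf_eq {p : ℕ} (hp : p.Prime) {G : Type*} [Group G] [Finite G]
    {g u w : G} (hu : u ^ p = 1) (hw : orderOf w = p) (hug : u ∈ Subgroup.zpowers g)
    (hwg : w ∈ Subgroup.zpowers g) : u ∈ Subgroup.zpowers w := by
  obtain ⟨d, hd⟩ : p ∣ orderOf g := hw ▸ orderOf_dvd_of_mem_zpowers hwg
  have hd0 : d ≠ 0 := by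
    rintro rfl
    exact (orderOf_pos g).ne' hd
  have key : ∀ v : G, v ^ p = 1 → v ∈ Subgroup.zpowers g → v ∈ Subgroup.zpowers (g ^ d) := by
    rintro _ hv ⟨i, rfl⟩
    simp only at hv
    rw [← zpow_natCast, ← zpow_mul, ← orderOf_dvd_iff_zpow_eq_one, hd, mul_comm i] at hv
    push_cast at hv
    obtain ⟨j, rfl⟩ := Int.dvd_of_mul_dvd_mul_left (by exact_mod_cast hp.ne_zero) hv
    exact ⟨j, by simp only; rw [zpow_mul, zpow_natCast]⟩
  have hgd : orderOf (g ^ d) = p := by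
    rw [orderOf_pow_of_dvd hd0 (hd ▸ dvd_mul_left d p), hd,
      Nat.mul_div_cancel _ (Nat.pos_of_ne_zero hd0)]
  have hle : Subgroup.zpowers w ≤ Subgroup.zpowers (g ^ d) :=
    Subgroup.zpowers_le.2 (key w (hw ▸ pow_orderOf_eq_one w) hwg)
  have heq : Subgroup.zpowers w = Subgroup.zpowers (g ^ d) :=
    Subgroup.eq_of_le_of_card_ge hle (by rw [Nat.card_zpowers, Nat.card_zpowers, hgd, hw])
  exact heq ▸ key u hu hug

theorem totient_orderOf_le_ncard_generators {G : Type*} [Group G] [Finite G] (g : G) :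
    (orderOf g).totient ≤ {h : G | Subgroup.zpowers h = Subgroup.zpowers g}.ncard := by
  classical
  have hinj : Set.InjOn (fun i : ℕ => g ^ i)
      ((Finset.range (orderOf g)).filter (orderOf g).Coprime : Set ℕ) := by
    intro i hi j hj hij
    simp only [Finset.coe_filter, Finset.mem_range, Set.mem_ofPred_eq] at hi hj
    exact pow_injOn_Iio_orderOf hi.1 hj.1 hij
  rw [Nat.totient, ← Finset.card_image_of_injOn hinj, ← Set.ncard_coe_finset]
  refine Set.ncard_le_ncard ?_ (Set.toFinite _)
  intro h hh
  simp only [Finset.coe_image, Finset.coe_filter, Finset.mem_range, Set.mem_image] at hh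
  obtain ⟨i, ⟨-, hi⟩, rfl⟩ := hh
  refine le_antisymm (Subgroup.zpowers_le.2 (Subgroup.npow_mem_zpowers g i))
    (Subgroup.zpowers_le.2 ?_)
  obtain ⟨m, hm⟩ := exists_pow_eq_self_of_coprime hi.symm
  exact ⟨m, by simpa using hm⟩

/-! ### Cut-sets of the power graph of a product of a `p`-group and a cyclic group. -/

theorem powerGraph_adj_of_mem {G : Type*} [Group G] {x y : G} (hne : x ≠ y)
    (h : x ∈ Subgroup.zpowers y) : (powerGraph G).Adj x y :=
  ⟨hne, Or.inl h⟩

theorem reachable_induce_of_mem {G : Type*} [Group G] {X : Set G} {x y : G} (hx : x ∉ X)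
    (hy : y ∉ X) (h : x ∈ Subgroup.zpowers y) :
    ((powerGraph G).induce Xᶜ).Reachable ⟨x, hx⟩ ⟨y, hy⟩ := by
  by_cases hne : x = y
  · subst hne
    exact SimpleGraph.Reachable.refl _
  · exact SimpleGraph.Adj.reachable (powerGraph_adj_of_mem hne h)

section Decomposition

variable {p : ℕ} {G : Type*} [Group G] {S : Subgroup G} {q : G}

/-- The hypotheses say that `G` is the direct product of `S` and `⟨q⟩`, of coprime orders. Outside
`⟨q⟩` the `S`-component is nontrivial. -/
theorem dvd_orderOf_of_notMem_zpowers (hp : p.Prime) (hS : IsPGroup p S)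
    (hq : p.Coprime (orderOf q)) (hcomm : ∀ x ∈ S, Commute x q)
    (hgen : ∀ g : G, ∃ x ∈ S, ∃ i : ℤ, g = x * q ^ i) {g : G} (hg : g ∉ Subgroup.zpowers q) :
    p ∣ orderOf g := by
  have : Fact p.Prime := ⟨hp⟩
  obtain ⟨x, hx, i, rfl⟩ := hgen g
  obtain ⟨c, hc⟩ := IsPGroup.iff_orderOf.1 hS ⟨x, hx⟩
  rw [Subgroup.orderOf_mk] at hc
  have hco : (orderOf x).Coprime (orderOf (q ^ i)) := by
    rw [hc]
    exact (hq.pow_left c).coprime_dvd_right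
      (orderOf_dvd_of_mem_zpowers (Subgroup.zpow_mem_zpowers q i))
  rw [((hcomm x hx).zpow_right i).orderOf_mul_eq_mul_orderOf_of_coprime hco]
  refine Dvd.dvd.mul_right ?_ _
  rw [hc]
  refine dvd_pow_self _ ?_
  rintro rfl
  rw [pow_zero, orderOf_eq_one_iff] at hc
  exact hg (by simp [hc])

/-- Take `h = x * q` with `x` the `S`-component of `g`, or any nontrivial element of `S` if that
component is 1. Having `c ≠ 0` yields the factor `p - 1` in the totient of `orderOf h`. -/
theorem exists_mem_zpowers_of_decomposition (hp : p.Prime) (hS : IsPGroup p S)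
    (hq : p.Coprime (orderOf q)) (hcomm : ∀ x ∈ S, Commute x q)
    (hgen : ∀ g : G, ∃ x ∈ S, ∃ i : ℤ, g = x * q ^ i) (hS1 : ∃ u ∈ S, u ≠ 1) (g : G) :
    ∃ h : G, g ∈ Subgroup.zpowers h ∧ q ∈ Subgroup.zpowers h ∧
      ∃ c ≠ 0, orderOf h = p ^ c * orderOf q := by
  have : Fact p.Prime := ⟨hp⟩
  have key : ∀ x ∈ S, x ≠ 1 → x ∈ Subgroup.zpowers (x * q) ∧ q ∈ Subgroup.zpowers (x * q) ∧
      ∃ c ≠ 0, orderOf (x * q) = p ^ c * orderOf q := by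
    intro x hx hx1
    obtain ⟨c, hc⟩ := IsPGroup.iff_orderOf.1 hS ⟨x, hx⟩
    rw [Subgroup.orderOf_mk] at hc
    have hco : (orderOf x).Coprime (orderOf q) := by
      rw [hc]
      exact hq.pow_left c
    refine ⟨(hcomm x hx).left_mem_zpowers_mul hco, (hcomm x hx).right_mem_zpowers_mul hco, c, ?_,
      by rw [(hcomm x hx).orderOf_mul_eq_mul_orderOf_of_coprime hco, hc]⟩
    rintro rfl
    rw [pow_zero, orderOf_eq_one_iff] at hc
    exact hx1 hc
  obtain ⟨x, hx, i, rfl⟩ := hgen g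
  by_cases hx1 : x = 1
  · obtain ⟨u, hu, hu1⟩ := hS1
    obtain ⟨-, h2, h3⟩ := key u hu hu1
    exact ⟨u * q, by simpa [hx1] using Subgroup.zpow_mem _ h2 i, h2, h3⟩
  · obtain ⟨h1, h2, h3⟩ := key x hx hx1
    exact ⟨x * q, Subgroup.mul_mem _ h1 (Subgroup.zpow_mem _ h2 i), h2, h3⟩

/-- The property `u ∈ ⟨g⟩` is invariant along walks avoiding `⟨q⟩`; it holds at `u` and fails at
`v`. -/
theorem isCutSet_zpowers [Finite G] (hp : p.Prime) (hS : IsPGroup p S)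
    (hq : p.Coprime (orderOf q)) (hcomm : ∀ x ∈ S, Commute x q)
    (hgen : ∀ g : G, ∃ x ∈ S, ∃ i : ℤ, g = x * q ^ i) {u v : G} (hu : orderOf u = p)
    (hv : orderOf v = p) (huv : v ∉ Subgroup.zpowers u) :
    IsCutSet (powerGraph G) (Subgroup.zpowers q : Set G) := by
  have hnot : ∀ w : G, orderOf w = p → w ∉ Subgroup.zpowers q := by
    intro w hw h
    have := orderOf_dvd_of_mem_zpowers h
    rw [hw, hp.dvd_iff_not_coprime] at this
    exact this hq
  have hdown : ∀ g h : G, h ∉ Subgroup.zpowers q → h ∈ Subgroup.zpowers g →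
      u ∈ Subgroup.zpowers g → u ∈ Subgroup.zpowers h := by
    intro g h hh hhg hug
    obtain ⟨d, hd⟩ := dvd_orderOf_of_notMem_zpowers hp hS hq hcomm hgen hh
    have hd0 : d ≠ 0 := by
      rintro rfl
      exact (orderOf_pos h).ne' hd
    have hw : orderOf (h ^ d) = p := by
      rw [orderOf_pow_of_dvd hd0 (hd ▸ dvd_mul_left d p), hd,
        Nat.mul_div_cancel _ (Nat.pos_of_ne_zero hd0)]
    exact Subgroup.zpowers_le.2 (Subgroup.npow_mem_zpowers h d)
      (mem_zpowers_of_orderOf_eq hp (hu ▸ pow_orderOf_eq_one u) hw hug (Subgroup.pow_mem _ hhg d))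
  intro hconn
  have hwalk : ∀ a b : ((Subgroup.zpowers q : Set G)ᶜ : Set G),
      ((powerGraph G).induce (Subgroup.zpowers q : Set G)ᶜ).Walk a b →
      u ∈ Subgroup.zpowers (a : G) → u ∈ Subgroup.zpowers (b : G) := by
    intro a b w
    induction w with
    | nil => exact id
    | @cons a c b hadj _ ih =>
      intro h
      apply ih
      rcases hadj.2 with hac | hca
      · exact Subgroup.zpowers_le.2 hac h
      · exact hdown a c c.2 hca h
  obtain ⟨w⟩ := hconn ⟨u, hnot u hu⟩ ⟨v, hnot v hv⟩
  have huv' := hwalk _ _ w (Subgroup.mem_zpowers u)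
  exact huv (mem_zpowers_of_orderOf_eq hp (hv ▸ pow_orderOf_eq_one v) hu
    (Subgroup.mem_zpowers v) huv')

theorem eq_zpowers_of_isCutSet [Finite G] (hp : p.Prime) (hS : IsPGroup p S)
    (hq : p.Coprime (orderOf q)) (hcomm : ∀ x ∈ S, Commute x q)
    (hgen : ∀ g : G, ∃ x ∈ S, ∃ i : ℤ, g = x * q ^ i) (hS1 : ∃ u ∈ S, u ≠ 1)
    (hphi : orderOf q ≤ (p - 1) * (orderOf q).totient)
    {X : Set G} (hX : IsCutSet (powerGraph G) X) (hcard : X.ncard ≤ orderOf q) :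
    X = (Subgroup.zpowers q : Set G) := by
  have h1X : (1 : G) ∈ X := by
    by_contra h1
    exact hX fun a b => (reachable_induce_of_mem h1 a.2 (Subgroup.one_mem _)).symm.trans
      (reachable_induce_of_mem h1 b.2 (Subgroup.one_mem _))
  have hcover : ∀ g : G, ∃ h, h ∉ X ∧ g ∈ Subgroup.zpowers h ∧ q ∈ Subgroup.zpowers h := by
    intro g
    obtain ⟨h, hgh, hqh, c, hc, hord⟩ :=
      exists_mem_zpowers_of_decomposition hp hS hq hcomm hgen hS1 g
    by_contra! hall
    -- The identity supplies the extra element that makes the count exceed `orderOf q` even when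
    -- `hphi` is an equality.
    have hsub : insert 1 {h' : G | Subgroup.zpowers h' = Subgroup.zpowers h} ⊆ X := by
      refine Set.insert_subset h1X fun h' hh' => ?_
      by_contra hn
      have hh'' : Subgroup.zpowers h' = Subgroup.zpowers h := hh'
      exact hall h' hn (hh'' ▸ hgh) (hh'' ▸ hqh)
    have h1 : (1 : G) ∉ {h' : G | Subgroup.zpowers h' = Subgroup.zpowers h} := by
      intro h1
      have h2 : Subgroup.zpowers (1 : G) = Subgroup.zpowers h := h1
      rw [Subgroup.zpowers_one_eq_bot, eq_comm, Subgroup.zpowers_eq_bot] at h2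
      rw [h2, orderOf_one] at hord
      exact hc ((Nat.pow_eq_one.1 (Nat.eq_one_of_mul_eq_one_right hord.symm)).resolve_left
        hp.one_lt.ne')
    have h2 := Set.ncard_le_ncard hsub (Set.toFinite _)
    rw [Set.ncard_insert_of_notMem h1 (Set.toFinite _)] at h2
    have h3 := totient_orderOf_le_ncard_generators h
    rw [hord, Nat.totient_mul (hq.pow_left c), Nat.totient_prime_pow hp (Nat.pos_of_ne_zero hc),
      mul_assoc] at h3
    have h4 := Nat.le_mul_of_pos_left ((p - 1) * (orderOf q).totient)
      (Nat.pow_pos (n := c - 1) hp.pos)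
    omega
  have hsub : (Subgroup.zpowers q : Set G) ⊆ X := by
    intro c hc
    by_contra hcX
    refine hX fun a b => ?_
    obtain ⟨ha, haX, haa, hqa⟩ := hcover a
    obtain ⟨hb, hbX, hbb, hqb⟩ := hcover b
    exact (((reachable_induce_of_mem a.2 haX haa).trans
      (reachable_induce_of_mem hcX haX (Subgroup.zpowers_le.2 hqa hc)).symm).trans
      (reachable_induce_of_mem hcX hbX (Subgroup.zpowers_le.2 hqb hc))).trans
      (reachable_induce_of_mem b.2 hbX hbb).symm
  refine (Set.eq_of_subset_of_ncard_le hsub ?_ (Set.toFinite _)).symm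
  rwa [ncard_zpowers]

end Decomposition

/-! ### The totient inequality. -/

/-- The worst case is `T = {2, ..., m + 1}`, where the product telescopes to `1 / (m + 1)`. In
general the largest of `m` distinct integers `≥ 2` is at least `m + 1`. -/
theorem one_div_card_add_one_le_prod (T : Finset ℕ) (hT : ∀ t ∈ T, 2 ≤ t) :
    (1 : ℚ) / (T.card + 1) ≤ ∏ t ∈ T, (1 - (t : ℚ)⁻¹) := by
  induction T using Finset.induction_on_max with
  | empty => simp
  | insert a T hmax ih =>
    have ha : a ∉ T := fun h => (hmax a h).false
    have hcard : T.card + 2 ≤ a := by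
      have hsub : T ⊆ Finset.Ico 2 a := fun t ht =>
        Finset.mem_Ico.2 ⟨hT t (Finset.mem_insert_of_mem ht), hmax t ht⟩
      have h1 := Finset.card_le_card hsub
      have h2 := hT a (Finset.mem_insert_self _ _)
      rw [Nat.card_Ico] at h1
      omega
    have ih' := ih fun t ht => hT t (Finset.mem_insert_of_mem ht)
    rw [Finset.prod_insert ha, Finset.card_insert_of_notMem ha]
    have hc : ((T.card : ℚ) + 2) ≤ a := by exact_mod_cast hcard
    have hinv : (a : ℚ)⁻¹ ≤ ((T.card : ℚ) + 2)⁻¹ := inv_anti₀ (by positivity) hc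
    have heq : (1 : ℚ) / ((T.card + 1 : ℕ) + 1) =
        (1 - ((T.card : ℚ) + 2)⁻¹) * (1 / (T.card + 1)) := by
      push_cast
      field_simp
      ring
    rw [heq]
    refine mul_le_mul (by linarith) ih' (by positivity) ?_
    have : (a : ℚ)⁻¹ ≤ 1 := Nat.cast_inv_le_one a
    linarith

theorem totient_prod_pow {ι : Type*} (s : Finset ι) {p n : ι → ℕ} (hp : ∀ i ∈ s, (p i).Prime)
    (hinj : Set.InjOn p s) (hn : ∀ i ∈ s, n i ≠ 0) :
    ((∏ i ∈ s, p i ^ n i).totient : ℚ) =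
      (∏ i ∈ s, p i ^ n i : ℕ) * ∏ i ∈ s, (1 - (p i : ℚ)⁻¹) := by
  classical
  have hpf : (∏ i ∈ s, p i ^ n i).primeFactors = s.image p := by
    ext q
    simp only [Nat.mem_primeFactors, Finset.mem_image]
    constructor
    · rintro ⟨hq, hdvd, -⟩
      obtain ⟨i, hi, hqi⟩ := (hq.prime.dvd_finsetProd_iff _).1 hdvd
      exact ⟨i, hi, ((Nat.prime_dvd_prime_iff_eq hq (hp i hi)).1 (hq.dvd_of_dvd_pow hqi)).symm⟩
    · rintro ⟨i, hi, rfl⟩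
      exact ⟨hp i hi, (dvd_pow_self _ (hn i hi)).trans (Finset.dvd_prod_of_mem _ hi),
        Finset.prod_ne_zero_iff.2 fun j hj => pow_ne_zero _ (hp j hj).ne_zero⟩
  rw [Nat.totient_eq_mul_prod_factors, hpf, Finset.prod_image hinj]

/-- Dividing by the product reduces the claim to `1 ≤ (p k - 1) ∏ (1 - 1 / p i)` over `i ≠ k`. If `p
k ≥ r + 1`, the `r - 1` factors multiply to at least `1 / r`. Otherwise the product is above `1 / 2`
and `p k ≥ 3`. -/
theorem prod_pow_le_pred_mul_totient {r : ℕ} (hr : 2 ≤ r) {p : Fin r → ℕ}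
    (hp : ∀ i, (p i).Prime) (hmono : StrictMono p) {n : Fin r → ℕ} (hn : ∀ i, 0 < n i) (k : Fin r)
    (hcond : r + 1 ≤ p k ∨
      2 * Nat.totient (∏ i ∈ Finset.univ.filter (fun i : Fin r => i.val + 1 < r), p i)
        > ∏ i ∈ Finset.univ.filter (fun i : Fin r => i.val + 1 < r), p i) :
    ∏ i ∈ Finset.univ.erase k, p i ^ n i ≤
      (p k - 1) * (∏ i ∈ Finset.univ.erase k, p i ^ n i).totient := by
  have hinj : Function.Injective p := hmono.injective
  have hphi := totient_prod_pow (Finset.univ.erase k) (n := n) (fun i _ => hp i) hinj.injOn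
    (fun i _ => (hn i).ne')
  have hpos : ∀ i, 0 < 1 - (p i : ℚ)⁻¹ := by
    intro i
    have : (1 : ℚ) < p i := by exact_mod_cast (hp i).one_lt
    have := inv_lt_one_of_one_lt₀ this
    linarith
  suffices h : (1 : ℚ) ≤ (p k - 1 : ℕ) * ∏ i ∈ Finset.univ.erase k, (1 - (p i : ℚ)⁻¹) by
    have h2 : ((∏ i ∈ Finset.univ.erase k, p i ^ n i : ℕ) : ℚ) ≤
        ((p k - 1) * (∏ i ∈ Finset.univ.erase k, p i ^ n i).totient : ℕ) := by
      rw [Nat.cast_mul, hphi, mul_left_comm]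
      exact le_mul_of_one_le_right (Nat.cast_nonneg _) h
    exact_mod_cast h2
  rcases hcond with hcond | hcond
  · have h1 := one_div_card_add_one_le_prod ((Finset.univ.erase k).image p) (by
      intro t ht
      obtain ⟨i, -, rfl⟩ := Finset.mem_image.1 ht
      exact (hp i).two_le)
    rw [Finset.prod_image hinj.injOn, Finset.card_image_of_injective _ hinj,
      Finset.card_erase_of_mem (Finset.mem_univ k), Finset.card_univ, Fintype.card_fin] at h1
    have h2 : ((r - 1 : ℕ) : ℚ) + 1 = r := by exact_mod_cast Nat.sub_add_cancel (by omega : 1 ≤ r)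
    rw [h2] at h1
    have hr0 : (0 : ℚ) < r := by exact_mod_cast (by omega : 0 < r)
    have h3 : (r : ℚ) ≤ (p k - 1 : ℕ) := by exact_mod_cast (by omega : r ≤ p k - 1)
    calc (1 : ℚ) = r * (1 / r) := by field_simp
      _ ≤ _ := mul_le_mul h3 h1 (by positivity) (Nat.cast_nonneg _)
  · let l : Fin r := ⟨r - 1, by omega⟩
    let z : Fin r := ⟨0, by omega⟩
    have hF : Finset.univ.filter (fun i : Fin r => i.val + 1 < r) = Finset.univ.erase l := by
      ext i
      simp only [Finset.mem_filter, Finset.mem_univ, true_and, Finset.mem_erase, and_true, l,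
        ne_eq, Fin.ext_iff]
      omega
    rw [hF] at hcond
    have hphi' := totient_prod_pow (Finset.univ.erase l) (p := p) (n := fun _ => 1)
      (fun i _ => hp i) hinj.injOn (fun i _ => one_ne_zero)
    simp only [pow_one] at hphi'
    have hMpos : (0 : ℚ) < (∏ i ∈ Finset.univ.erase l, p i : ℕ) := by
      exact_mod_cast Finset.prod_pos fun i _ => (hp i).pos
    have hhalf : (1 : ℚ) < 2 * ∏ i ∈ Finset.univ.erase l, (1 - (p i : ℚ)⁻¹) := by
      have h1 : ((∏ i ∈ Finset.univ.erase l, p i : ℕ) : ℚ) <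
          2 * (∏ i ∈ Finset.univ.erase l, p i).totient := by exact_mod_cast hcond
      rw [hphi', mul_left_comm] at h1
      exact (lt_mul_iff_one_lt_right hMpos).1 h1
    -- If 2 occurs among the primes it is the first, and its factor alone brings the product over `i
    -- ≠ l` down to `1 / 2`.
    have hpk : p k ≠ 2 := by
      intro hk2
      have hz2 : p z = 2 := le_antisymm
        (hk2 ▸ hmono.monotone (Fin.mk_le_of_le_val (Nat.zero_le _))) (hp z).two_le
      have hzl : z ∈ Finset.univ.erase l := by
        simp only [Finset.mem_erase, Finset.mem_univ, and_true, z, l, ne_eq, Fin.ext_iff]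
        omega
      have h1 : ∏ i ∈ (Finset.univ.erase l).erase z, (1 - (p i : ℚ)⁻¹) ≤ 1 :=
        Finset.prod_le_one (fun i _ => (hpos i).le) fun i _ => by
          have : (0 : ℚ) ≤ (p i : ℚ)⁻¹ := by positivity
          linarith
      rw [← Finset.mul_prod_erase _ _ hzl, hz2] at hhalf
      norm_num at hhalf
      linarith
    -- Omitting the largest prime omits the largest factor, so it leaves the smallest product.
    have hle : ∏ i ∈ Finset.univ.erase l, (1 - (p i : ℚ)⁻¹) ≤
        ∏ i ∈ Finset.univ.erase k, (1 - (p i : ℚ)⁻¹) := by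
      have h1 := Finset.mul_prod_erase Finset.univ (fun i => 1 - (p i : ℚ)⁻¹) (Finset.mem_univ k)
      rw [← Finset.mul_prod_erase Finset.univ (fun i => 1 - (p i : ℚ)⁻¹) (Finset.mem_univ l)] at h1
      have h2 : 1 - (p k : ℚ)⁻¹ ≤ 1 - (p l : ℚ)⁻¹ := by
        have h3 : p k ≤ p l := hmono.monotone (Fin.mk_le_mk.2 (by omega))
        have : (p l : ℚ)⁻¹ ≤ (p k : ℚ)⁻¹ :=
          inv_anti₀ (by exact_mod_cast (hp k).pos) (by exact_mod_cast h3)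
        linarith
      have h4 : 0 ≤ ∏ i ∈ Finset.univ.erase l, (1 - (p i : ℚ)⁻¹) :=
        Finset.prod_nonneg fun i _ => (hpos i).le
      refine le_of_mul_le_mul_left ?_ (hpos k)
      rw [h1]
      exact mul_le_mul_of_nonneg_right h2 h4
    have h2 : (2 : ℚ) ≤ (p k - 1 : ℕ) := by
      have := (hp k).two_le
      exact_mod_cast (by omega : 2 ≤ p k - 1)
    have h3 : 0 ≤ ∏ i ∈ Finset.univ.erase k, (1 - (p i : ℚ)⁻¹) :=
      Finset.prod_nonneg fun i _ => (hpos i).le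
    have h4 := mul_le_mul_of_nonneg_right h2 h3
    linarith

/-! ### The subgroup `Q`, the vertex connectivity and the main theorem. -/

/-- A product of normal cyclic subgroups of pairwise coprime orders is normal and cyclic. -/
theorem exists_zpowers_eq_list_prod {G ι : Type*} [Group G] [Finite G] {P : ι → Subgroup G}
    (l : List ι) (hl : l.Nodup) (hP : ∀ i ∈ l, (P i).Normal) (hcyc : ∀ i ∈ l, IsCyclic (P i))
    (hco : ∀ i ∈ l, ∀ j ∈ l, i ≠ j → (Nat.card (P i)).Coprime (Nat.card (P j))) :
    ∃ g : G, (Subgroup.zpowers g).Normal ∧ orderOf g = (l.map fun i => Nat.card (P i)).prod ∧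
      (l.map fun i => (P i : Set G)).prod = Subgroup.zpowers g := by
  induction l with
  | nil => exact ⟨1, by rw [Subgroup.zpowers_one_eq_bot]; infer_instance, by simp, by
      simp [Subgroup.zpowers_one_eq_bot, ← Set.singleton_one]⟩
  | cons i l ih =>
    simp only [List.mem_cons, forall_eq_or_imp] at hP hcyc hco
    obtain ⟨g, hgn, hg, hprod⟩ := ih (List.nodup_cons.1 hl).2 hP.2 hcyc.2
      (fun j hj => (hco.2 j hj).2)
    obtain ⟨h, hh⟩ := (Subgroup.isCyclic_iff_exists_zpowers_eq_top _).1 hcyc.1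
    have hPn := hP.1
    have hoh : orderOf h = Nat.card (P i) := by rw [← hh, Nat.card_zpowers]
    have hcop : (orderOf h).Coprime (orderOf g) := by
      rw [hoh, hg]
      refine Nat.Coprime.symm (Nat.coprime_list_prod_left_iff.2 ?_)
      intro m hm
      obtain ⟨j, hj, rfl⟩ := List.mem_map.1 hm
      refine (hco.1.2 j hj ?_).symm
      rintro rfl
      exact (List.nodup_cons.1 hl).1 hj
    have hdisj : Disjoint (P i) (Subgroup.zpowers g) := by
      apply Subgroup.disjoint_of_coprime_natCard
      rwa [Nat.card_zpowers, ← hoh]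
    have hcomm : Commute h g := Subgroup.commute_of_normal_of_disjoint _ _ hPn hgn hdisj h g
      (hh ▸ Subgroup.mem_zpowers h) (Subgroup.mem_zpowers g)
    have heq : P i ⊔ Subgroup.zpowers g = Subgroup.zpowers (h * g) := by
      rw [← hh]
      refine le_antisymm (sup_le ?_ ?_) ?_
      · exact Subgroup.zpowers_le.2 (hcomm.left_mem_zpowers_mul hcop)
      · exact Subgroup.zpowers_le.2 (hcomm.right_mem_zpowers_mul hcop)
      · exact Subgroup.zpowers_le.2 (Subgroup.mul_mem_sup (Subgroup.mem_zpowers h)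
          (Subgroup.mem_zpowers g))
    refine ⟨h * g, heq ▸ Subgroup.sup_normal _ _, ?_, ?_⟩
    · rw [hcomm.orderOf_mul_eq_mul_orderOf_of_coprime hcop, List.map_cons, List.prod_cons, hoh, hg]
    · rw [List.map_cons, List.prod_cons, hprod, ← heq, Subgroup.mul_normal]

/-- Leaving a single vertex costs `|V| - 1 ≥ |X|` vertices, so that alternative never beats `X`. -/
theorem vertexConnectivity_eq {V : Type*} [Finite V] [Nonempty V] {Γ : SimpleGraph V} {X : Set V}
    (hX : IsMinimumCutSet Γ X) (hlt : X.ncard < Nat.card V) :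
    vertexConnectivity Γ = X.ncard := by
  apply le_antisymm
  · exact Nat.sInf_le ⟨X, Or.inl hX.1, rfl⟩
  · refine le_csInf ⟨X.ncard, X, Or.inl hX.1, rfl⟩ ?_
    rintro _ ⟨Y, hY | hY, rfl⟩
    · exact hX.2 Y hY
    · have := Set.ncard_add_ncard_compl Y
      omega

end PowerGraph

theorem theorem1p2 {G : Type*} [Group G] [Finite G]
    (hnil : Group.IsNilpotent G) (hncyc : ¬ IsCyclic G)
    (r : ℕ) (hr : 2 ≤ r)
    (p : Fin r → ℕ) (hp : ∀ i, (p i).Prime) (hmono : StrictMono p)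
    (n : Fin r → ℕ) (hn : ∀ i, 0 < n i)
    (hcard : Nat.card G = ∏ i, p i ^ n i)
    (P : ∀ i, Sylow (p i) G)
    (k : Fin r)
    (hcyc : ∀ i, i ≠ k → IsCyclic (P i))
    (hk : ¬ IsCyclic (P k))
    (hquat : p k = 2 → ¬ PowerGraph.IsGeneralizedQuaternion (P k))
    (hcond : r + 1 ≤ p k ∨
      2 * Nat.totient (∏ i ∈ Finset.univ.filter (fun i : Fin r => i.val + 1 < r), p i)
        > ∏ i ∈ Finset.univ.filter (fun i : Fin r => i.val + 1 < r), p i) :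
    (∀ X : Set G, PowerGraph.IsMinimumCutSet (PowerGraph.powerGraph G) X ↔
      X = PowerGraph.prodOmit (fun i => (P i : Set G)) k) ∧
    PowerGraph.vertexConnectivity (PowerGraph.powerGraph G) = Nat.card G / p k ^ n k := by
  have hfact : ∀ i, Fact (p i).Prime := fun i => ⟨hp i⟩
  -- This is where nilpotency enters.
  have hnormal : ∀ i, ((P i : Subgroup G)).Normal := fun i => inferInstance
  have hcop : ∀ i j, i ≠ j → (p i ^ n i).Coprime (p j ^ n j) := fun i j hij =>
    Nat.Coprime.pow _ _ ((Nat.coprime_primes (hp i) (hp j)).2 (hmono.injective.ne hij))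
  have hPcard : ∀ i, Nat.card (P i : Subgroup G) = p i ^ n i := by
    intro i
    have h1 := (P i).card_eq_multiplicity
    rw [h1, hcard, Nat.factorization_prod_apply
      fun j _ => pow_ne_zero _ (hp j).ne_zero, Finset.sum_eq_single i]
    · rw [(hp i).factorization_pow, Finsupp.single_eq_same]
    · intro j _ hj
      rw [(hp j).factorization_pow, Finsupp.single_eq_of_ne]
      exact (hmono.injective.ne hj).symm
    · exact fun h => absurd (Finset.mem_univ i) h
  obtain ⟨q, hqn, hq, hprod⟩ := PowerGraph.exists_zpowers_eq_list_prod
    (P := fun i => (P i : Subgroup G)) ((List.finRange r).filter (fun i => i ≠ k))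
    ((List.nodup_finRange r).filter _) (fun i _ => hnormal i)
    (fun i hi => hcyc i (by simpa using hi))
    (fun i _ j _ hij => by rw [hPcard, hPcard]; exact hcop i j hij)
  have hQ : PowerGraph.prodOmit (fun i => (P i : Set G)) k = Subgroup.zpowers q := hprod
  have hq' : orderOf q = ∏ i ∈ Finset.univ.erase k, p i ^ n i := by
    rw [hq]
    simp only [hPcard]
    rw [← List.prod_toFinset _ ((List.nodup_finRange r).filter _)]
    congr 1
    ext i
    simp
  have hmul : p k ^ n k * orderOf q = Nat.card G := by
    rw [hq', hcard, Finset.mul_prod_erase _ (fun i => p i ^ n i) (Finset.mem_univ k)]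
  have hpq : (p k).Coprime (orderOf q) := by
    rw [hq']
    refine Nat.Coprime.prod_right fun i hi => ?_
    exact Nat.Coprime.coprime_dvd_left (dvd_pow_self _ (hn k).ne')
      (hcop k i (Finset.ne_of_mem_erase hi).symm)
  have hcompl : (P k : Subgroup G).IsComplement' (Subgroup.zpowers q) := by
    apply Subgroup.isComplement'_of_coprime
    · rw [hPcard, Nat.card_zpowers, hmul]
    · rw [hPcard, Nat.card_zpowers]
      exact hpq.pow_left _
  have hcomm : ∀ x ∈ (P k : Subgroup G), Commute x q := fun x hx =>
    Subgroup.commute_of_normal_of_disjoint _ _ (hnormal k) hqn hcompl.disjoint x q hx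
      (Subgroup.mem_zpowers q)
  have hgen : ∀ g : G, ∃ x ∈ (P k : Subgroup G), ∃ i : ℤ, g = x * q ^ i := by
    intro g
    obtain ⟨⟨⟨x, hx⟩, ⟨_, i, rfl⟩⟩, h⟩ := hcompl.2 g
    exact ⟨x, hx, i, h.symm⟩
  obtain ⟨u, v, hu, hv, huv⟩ := (P k).isPGroup'.exists_two_zpowers_of_orderOf_eq hk hquat
  have hu' : orderOf (u : G) = p k := by rw [Subgroup.orderOf_coe, hu]
  have hv' : orderOf (v : G) = p k := by rw [Subgroup.orderOf_coe, hv]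
  have huv' : (v : G) ∉ Subgroup.zpowers (u : G) := by
    rintro ⟨i, hi⟩
    exact huv ⟨i, Subtype.ext (by simpa using hi)⟩
  have hu1 : (u : G) ≠ 1 := by
    intro h
    rw [h, orderOf_one] at hu'
    exact (hp k).one_lt.ne hu'
  have hphi : orderOf q ≤ (p k - 1) * (orderOf q).totient := by
    rw [hq']
    exact PowerGraph.prod_pow_le_pred_mul_totient hr hp hmono hn k hcond
  have hncard : (Subgroup.zpowers q : Set G).ncard = orderOf q :=
    PowerGraph.ncard_zpowers q
  have hcut : PowerGraph.IsCutSet (PowerGraph.powerGraph G) (Subgroup.zpowers q : Set G) :=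
    PowerGraph.isCutSet_zpowers (hp k) (P k).isPGroup' hpq hcomm hgen hu' hv' huv'
  have huniq : ∀ X, PowerGraph.IsCutSet (PowerGraph.powerGraph G) X → X.ncard ≤ orderOf q →
      X = (Subgroup.zpowers q : Set G) := fun X =>
    PowerGraph.eq_zpowers_of_isCutSet (hp k) (P k).isPGroup' hpq hcomm hgen ⟨u, u.2, hu1⟩ hphi
  have hmin : PowerGraph.IsMinimumCutSet (PowerGraph.powerGraph G)
      (Subgroup.zpowers q : Set G) := by
    refine ⟨hcut, fun Y hY => ?_⟩
    rcases le_or_gt Y.ncard (orderOf q) with h | h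
    · rw [huniq Y hY h]
    · exact hncard.trans_le h.le
  refine ⟨fun X => ?_, ?_⟩
  · rw [hQ]
    refine ⟨fun hX => huniq X hX.1 ((hX.2 _ hcut).trans_eq hncard), ?_⟩
    rintro rfl
    exact hmin
  · rw [PowerGraph.vertexConnectivity_eq hmin, hncard, ← hmul,
      Nat.mul_div_cancel_left _ (pow_pos (hp k).pos _)]
    rw [hncard, ← hmul]
    exact lt_mul_of_one_lt_left (orderOf_pos q) (Nat.one_lt_pow (hn k).ne' (hp k).one_lt)
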